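/- A Tree MDP consists of a finite set $\mathcal S$ of non-terminal states, a finite set $\Sigma$ of terminal states, a set $\mathcal A$ of actions, a starting state $s_1\in\mathcal S$, a horizon $\mathcal H\ge 1$, a discount factor $\gamma\in[0,1]$, transition probabilities $p(s,a,s')$ and known rewards $r(s,a,s')$ for $s\in\mathcal S$, $a\in\mathcal A$, $s'\in\mathcal S\cup\Sigma$, such that the states form a tree rooted at $s_1$: every state $s'\neq s_1$ has exactly one parent $s\in\mathcal S$ and exactly one action $a$ leading from $s$ to $s'$, $p(s,a,\cdot)$ is a probability distribution on the states reached from $s$ through $a$, and non-terminal states have levels in $\{1,\dots,\mathcal H\}$, where $s_1$ has level $1$ and a child has a level one higher than its parent. If the path from $s_1$ to $\sigma\in\Sigma$ is $s_1,a_1,\dots,s_m,a_m,s_{m+1}=\sigma$, its return is $\rho(\sigma)=\sum_{i=1}^m\gamma^{i-1}r(s_i,a_i,s_{i+1})$; all returns $\rho(\sigma)$, $\sigma\in\Sigma$, are assumed to lie in $[0,1]$. A (deterministic) policy is a map $\pi:\mathcal S\to\mathcal A$; its value $V(\pi)=V^\pi(s_1)$ is given by the Bellman equation $V^\pi(s)=\sum_{s'}p(s,\pi(s),s')\,(r(s,\pi(s),s')+\gamma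 V^\pi(s'))$, with $V^\pi=0$ on $\Sigma$. $X(\pi)$ is the set of terminal states $\sigma$ with which $\pi$ is consistent, that is, $\pi(s_i)=a_i$ along the path to $\sigma$. A learning algorithm picks before each episode, possibly at random and depending on the policies played and the trajectories observed so far, a policy to be played, or it stops. An episode starts in $s_1$ and follows the policy, with next states sampled from $p$, until a terminal state is reached. After $t$ episodes let $N^t(\sigma)$ be the number of episodes whose policy was consistent with $\sigma$, let $N^t_+(\sigma)$ be the number of episodes that ended in $\sigma$, and put $$N^t(\pi)=\min_{\sigma\in X(\pi)}N^t(\sigma),\qquad \widehat V^t(\pi)=\sum_{\sigma\in X(\pi)}\frac{N^t_+(\sigma)}{N^t(\sigma)}\rho(\sigma),\qquad \beta(m,\delta)=\sqrt{\frac{8}{3m}\ln\frac1\delta},$$ $$\mathrm{ucb}^t(\pi,\delta)=\widehat V^t(\pi)+\beta(N^t(\pi),\delta),\qquad \mathrm{lcb}^t(\pi,\delta)=\min\{\widehat V^t(\pi),1\}-\beta(N^t(\pi),\delta).$$ **Theorem.** For every Tree MDP as above, every learning algorithm, every policy $\pi$, every $t\ge1$, every family of counts $(n^t(\sigma))_{\sigma\in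 X(\pi)}$ with $1\le n^t(\sigma)\le t$, and every $\delta\in(0,1)$, the probability that $t$ episodes are played, that $N^t(\sigma)=n^t(\sigma)$ for all $\sigma\in X(\pi)$, and that $V(\pi)\ge\mathrm{ucb}^t(\pi,\delta)$, is at most $\delta$; and the probability that $t$ episodes are played, that $N^t(\sigma)=n^t(\sigma)$ for all $\sigma\in X(\pi)$, and that $V(\pi)\le\mathrm{lcb}^t(\pi,\delta)$, is at most $\delta$. -/

import Mathlib

open scoped ENNReal

/-- A finite-horizon tree MDP with non-terminal states `S`, terminal states `T`, actions `A`.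
Apart from the root, every state has exactly one parent state and is reached from it through
exactly one action; `parent x = some (s, a)` records this pair. Transitions go from a state only
to its children, non-terminal states have levels `1, …, horizon`, and the root has level `1`. -/
structure TreeMDP (S T A : Type*) where
  /-- the starting state -/
  root : S
  /-- transition probabilities -/
  p : S → A → PMF (S ⊕ T)
  /-- rewards -/
  r : S → A → S ⊕ T → ℝ
  /-- discount factor -/
  γ : ℝ
  /-- horizon -/
  horizon : ℕ
  /-- the parent of a state in the tree, with the action that leads from there to the state -/
  parent : S ⊕ T → Option (S × A)
  /-- the level of a state in the tree -/
  level : S ⊕ T → ℕ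
  γ_mem : γ ∈ Set.Icc (0 : ℝ) 1
  parent_eq_none_iff : ∀ x, parent x = none ↔ x = Sum.inl root
  level_root : level (Sum.inl root) = 1
  level_child : ∀ x s a, parent x = some (s, a) → level x = level (Sum.inl s) + 1
  level_le_horizon : ∀ s : S, level (Sum.inl s) ≤ horizon
  parent_of_p_ne_zero : ∀ s a x, p s a x ≠ 0 → parent x = some (s, a)

namespace TreeMDP

variable {S T A : Type*}

/-- A deterministic policy. -/
abbrev Policy (S A : Type*) := S → A

/-- A trajectory: the state-action pairs in the order of play, and the terminal state reached. -/
abbrev Trajectory (S T A : Type*) := List (S × A) × T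

/-- What has been played and observed so far, oldest episode first. -/
abbrev History (S T A : Type*) := List (Policy S A × Trajectory S T A)

/-- A learning algorithm: from the history it picks, possibly at random, the policy of the next
episode, or it stops (`none`). -/
abbrev Algorithm (S T A : Type*) := History S T A → PMF (Option (Policy S A))

theorem sub_level_lt (M : TreeMDP S T A) {x : S ⊕ T} {s : S} {a : A}
    (h : M.parent x = some (s, a)) :
    M.horizon + 1 - M.level x < M.horizon + 1 - M.level (Sum.inl s) := by
  have h1 := M.level_child x s a h
  have h2 := M.level_le_horizon s
  omega

/-! ### Values -/

open Classical in
/-- The value `V^π` of a state (zero at terminal states), by recursion up the tree. The sum runs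
over the children of `s` under the action `π s`; all other states have probability zero. -/
noncomputable def stateValue [Fintype S] [Fintype T] (M : TreeMDP S T A) (π : Policy S A) :
    S ⊕ T → ℝ
  | Sum.inr _ => 0
  | Sum.inl s => ∑ x : S ⊕ T,
      if _h : M.parent x = some (s, π s) then
        (M.p s (π s) x).toReal * (M.r s (π s) x + M.γ * stateValue M π x)
      else 0
termination_by x => M.horizon + 1 - M.level x
decreasing_by exact M.sub_level_lt _h

theorem stateValue_terminal [Fintype S] [Fintype T] (M : TreeMDP S T A) (π : Policy S A) (σ : T) :
    M.stateValue π (Sum.inr σ) = 0 := by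
  rw [stateValue]

/-- The Bellman equation. -/
theorem stateValue_bellman [Fintype S] [Fintype T] (M : TreeMDP S T A) (π : Policy S A) (s : S) :
    M.stateValue π (Sum.inl s) = ∑ x : S ⊕ T,
      (M.p s (π s) x).toReal * (M.r s (π s) x + M.γ * M.stateValue π x) := by
  rw [stateValue]
  refine Finset.sum_congr rfl fun x _ => ?_
  split_ifs with h
  · rfl
  · have h0 : M.p s (π s) x = 0 := by
      by_contra h1
      exact h (M.parent_of_p_ne_zero s (π s) x h1)
    simp [h0]

/-- `V(π)`, the value of `π` at the starting state. -/
noncomputable def value [Fintype S] [Fintype T] (M : TreeMDP S T A) (π : Policy S A) : ℝ :=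
  M.stateValue π (Sum.inl M.root)

/-! ### Paths, returns, consistency -/

/-- The path from the root to a state, as the list of its transitions `(s_i, a_i, s_{i+1})`. -/
def path (M : TreeMDP S T A) (x : S ⊕ T) : List (S × A × (S ⊕ T)) :=
  match _h : M.parent x with
  | none => []
  | some (s, a) => path M (Sum.inl s) ++ [(s, a, x)]
termination_by M.level x
decreasing_by
  have := M.level_child x s a _h
  omega

theorem path_of_parent (M : TreeMDP S T A) {x : S ⊕ T} {s : S} {a : A}
    (h : M.parent x = some (s, a)) : M.path x = M.path (Sum.inl s) ++ [(s, a, x)] := by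
  rw [path]
  split
  · simp_all
  · rename_i s' a' h'
    rw [h] at h'
    cases h'
    rfl

theorem path_root (M : TreeMDP S T A) : M.path (Sum.inl M.root) = [] := by
  have h := (M.parent_eq_none_iff (Sum.inl M.root)).2 rfl
  rw [path]
  split
  · rfl
  · simp_all

/-- `ρ(x)`: the discounted cumulative reward along the path to `x`. -/
noncomputable def pathReturn (M : TreeMDP S T A) (x : S ⊕ T) : ℝ :=
  ((M.path x).mapIdx fun i e => M.γ ^ i * M.r e.1 e.2.1 e.2.2).sum

/-- The policy takes, at every state of the path to `σ`, the action that the path takes. -/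
def Consistent (M : TreeMDP S T A) (π : Policy S A) (σ : T) : Prop :=
  ∀ e ∈ M.path (Sum.inr σ), π e.1 = e.2.1

open Classical in
/-- `X(π)`: the terminal states with which `π` is consistent. -/
noncomputable def X [Fintype T] (M : TreeMDP S T A) (π : Policy S A) : Finset T :=
  {σ | M.Consistent π σ}

theorem X_nonempty [Fintype T] (M : TreeMDP S T A) (π : Policy S A) : (M.X π).Nonempty := by
  have key : ∀ k : ℕ, ∀ x : S ⊕ T, M.horizon + 1 - M.level x = k →
      (∀ e ∈ M.path x, π e.1 = e.2.1) → ∃ σ, M.Consistent π σ := by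
    intro k
    induction k using Nat.strong_induction_on with
    | _ k ih =>
      intro x hk hx
      cases x with
      | inr σ => exact ⟨σ, hx⟩
      | inl s =>
        obtain ⟨y, hy⟩ := (M.p s (π s)).support_nonempty
        have hp := M.parent_of_p_ne_zero s (π s) y ((PMF.mem_support_iff _ _).1 hy)
        refine ih _ (hk ▸ M.sub_level_lt hp) y rfl ?_
        intro e he
        rw [M.path_of_parent hp, List.mem_append, List.mem_singleton] at he
        rcases he with he | rfl
        · exact hx e he
        · rfl
  obtain ⟨σ, hσ⟩ := key _ (Sum.inl M.root) rfl (by simp [M.path_root])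
  exact ⟨σ, by simpa [X] using hσ⟩

/-! ### Interaction of an algorithm with the MDP -/

/-- The random remainder of an episode in which `π` is played and the current state is `x`: next
states are sampled from `p` until a terminal state is reached. -/
noncomputable def rollout (M : TreeMDP S T A) (π : Policy S A) :
    S ⊕ T → PMF (Trajectory S T A)
  | Sum.inr σ => PMF.pure ([], σ)
  | Sum.inl s => (M.p s (π s)).bindOnSupport fun x _hx =>
      (rollout M π x).map fun τ => ((s, π s) :: τ.1, τ.2)
termination_by x => M.horizon + 1 - M.level x
decreasing_by exact M.sub_level_lt (M.parent_of_p_ne_zero _ _ _ ((PMF.mem_support_iff _ _).1 _hx))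

theorem rollout_terminal (M : TreeMDP S T A) (π : Policy S A) (σ : T) :
    M.rollout π (Sum.inr σ) = PMF.pure ([], σ) := by
  rw [rollout]

theorem rollout_nonterminal (M : TreeMDP S T A) (π : Policy S A) (s : S) :
    M.rollout π (Sum.inl s) = (M.p s (π s)).bind fun x =>
      (M.rollout π x).map fun τ => ((s, π s) :: τ.1, τ.2) := by
  rw [rollout]
  exact PMF.bindOnSupport_eq_bind _ _

/-- The law of the history after `t` episodes; `none` if the algorithm stopped earlier. -/
noncomputable def run (M : TreeMDP S T A) (alg : Algorithm S T A) :
    ℕ → PMF (Option (History S T A))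
  | 0 => PMF.pure (some [])
  | t + 1 => (run M alg t).bind fun
    | none => PMF.pure none
    | some h => (alg h).bind fun
      | none => PMF.pure none
      | some π => (M.rollout π (Sum.inl M.root)).map fun τ => some (h ++ [(π, τ)])

/-! ### Counts, estimates, confidence bounds -/

open Classical in
/-- The play count of `σ`: the number of episodes whose policy was consistent with `σ`. -/
noncomputable def playCount (M : TreeMDP S T A) (h : History S T A) (σ : T) : ℕ :=
  h.countP fun e => decide (M.Consistent e.1 σ)

open Classical in
/-- The number of episodes that ended in `σ`. -/
noncomputable def reachCount (h : History S T A) (σ : T) : ℕ :=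
  h.countP fun e => decide (e.2.2 = σ)

/-- The play count of `π`: that of the least-played terminal state in `X(π)`. -/
noncomputable def policyCount [Fintype T] (M : TreeMDP S T A) (h : History S T A)
    (π : Policy S A) : ℕ :=
  (M.X π).inf' (M.X_nonempty π) (M.playCount h)

/-- The empirical estimate of `V(π)`. -/
noncomputable def valueEstimate [Fintype T] (M : TreeMDP S T A) (h : History S T A)
    (π : Policy S A) : ℝ :=
  ∑ σ ∈ M.X π, (reachCount h σ : ℝ) / (M.playCount h σ : ℝ) * M.pathReturn (Sum.inr σ)

/-- The confidence width `β(m, δ)`, for `m ≥ 1`. -/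
noncomputable def width (m : ℕ) (δ : ℝ) : ℝ :=
  Real.sqrt (8 / (3 * (m : ℝ)) * Real.log (1 / δ))

/-- The upper confidence bound. -/
noncomputable def ucb [Fintype T] (M : TreeMDP S T A) (h : History S T A)
    (π : Policy S A) (δ : ℝ) : ℝ :=
  M.valueEstimate h π + width (M.policyCount h π) δ

/-- The lower confidence bound. -/
noncomputable def lcb [Fintype T] (M : TreeMDP S T A) (h : History S T A)
    (π : Policy S A) (δ : ℝ) : ℝ :=
  min (M.valueEstimate h π) 1 - width (M.policyCount h π) δ

/-- The probability that `t` episodes are played and their history satisfies `E`. -/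
noncomputable def runProb (M : TreeMDP S T A) (alg : Algorithm S T A) (t : ℕ)
    (E : History S T A → Prop) : ℝ≥0∞ :=
  (M.run alg t).toOuterMeasure {o | ∃ h, o = some h ∧ E h}

end TreeMDP

/-! ### Expectations under a `PMF`, and an exponential inequality -/

namespace PMF

/-! The argument is a Chernoff bound for an adaptively collected sample. Write q(σ) for the
probability that π reaches σ. In a tree, a policy consistent with σ reaches it with probability
q(σ), any other with probability 0 (`terminalLaw_apply_congr`, `consistent_of_terminalLaw_ne_zero`).
So an episode ending in σ can be compensated by (c + 2/3 c²) q(σ), charged exactly when the policy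
played is consistent with σ, and the exponential of the accumulated log-weight is a supermartingale
for every algorithm (`tsum_run_mul_runWeight_le`). Once the play counts are fixed to n, the
compensator is deterministic. Since V(π) = Σ q(σ) ρ(σ) (`value_eq_sum`), taking c(σ) = k ρ(σ) / n(σ)
turns the log-weight into k times the estimation error, minus at most 2/3 k² / m with m = min n
(`le_sum_map_logWeight`). Optimizing k and applying Markov's inequality gives the width β. -/

theorem tsum_pure_mul {α : Type*} (a : α) (f : α → ℝ≥0∞) :
    ∑' x, PMF.pure a x * f x = f a := by
  rw [tsum_eq_single a]
  · simp
  · intro b hb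
    simp [PMF.pure_apply, hb]

theorem tsum_bind_mul {α β : Type*} (p : PMF α) (g : α → PMF β) (f : β → ℝ≥0∞) :
    ∑' y, p.bind g y * f y = ∑' x, p x * ∑' y, g x y * f y := by
  simp_rw [PMF.bind_apply, ← ENNReal.tsum_mul_right, ← ENNReal.tsum_mul_left, mul_assoc]
  exact ENNReal.tsum_comm

theorem tsum_map_mul {α β : Type*} (p : PMF α) (g : α → β) (f : β → ℝ≥0∞) :
    ∑' y, p.map g y * f y = ∑' x, p x * f (g x) := by
  rw [PMF.map, tsum_bind_mul]
  simp_rw [Function.comp_apply, tsum_pure_mul]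

theorem sum_toReal {α : Type*} [Fintype α] (p : PMF α) : ∑ x, (p x).toReal = 1 := by
  rw [← ENNReal.toReal_sum fun x _ => p.apply_ne_top x, ← tsum_fintype (L := .unconditional _), p.tsum_coe,
    ENNReal.toReal_one]

end PMF

/-- The constant `2 / 3` is what makes the Bernstein bound fit the width `8 / (3 m)`. -/
theorem Real.exp_le_one_add_add_sq {x : ℝ} (hx : |x| ≤ 3 / 4) :
    Real.exp x ≤ 1 + x + 2 / 3 * x ^ 2 := by
  -- The cubic remainder is at most 2/9 |x|³ ≤ 1/6 x², and 1/2 + 1/6 = 2/3.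
  have h := Real.exp_bound (x := x) (by linarith) (n := 3) (by norm_num)
  have h2 := (abs_le.1 h).2
  norm_num [Finset.sum_range_succ, Nat.factorial] at h2
  have h3 : |x| ^ 3 ≤ 3 / 4 * x ^ 2 := by
    rw [pow_succ, sq_abs, mul_comm]
    exact mul_le_mul_of_nonneg_right hx (sq_nonneg x)
  linarith

namespace TreeMDP

variable {S T A : Type*}

/-! ### The law of the terminal state -/

/-- The law of the terminal state reached from `x` when `π` is played. -/
noncomputable def terminalLaw (M : TreeMDP S T A) (π : Policy S A) (x : S ⊕ T) : PMF T :=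
  (M.rollout π x).map Prod.snd

theorem terminalLaw_terminal (M : TreeMDP S T A) (π : Policy S A) (σ : T) :
    M.terminalLaw π (Sum.inr σ) = PMF.pure σ := by
  rw [terminalLaw, rollout_terminal, PMF.pure_map]

theorem terminalLaw_nonterminal (M : TreeMDP S T A) (π : Policy S A) (s : S) :
    M.terminalLaw π (Sum.inl s) = (M.p s (π s)).bind (M.terminalLaw π) := by
  rw [terminalLaw, rollout_nonterminal, PMF.map_bind]
  congr 1
  funext x
  rw [PMF.map_comp]
  rfl

/-- Induction up the tree, along the children that a policy can reach. -/
theorem policy_induction (M : TreeMDP S T A) {P : S ⊕ T → Prop}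
    (terminal : ∀ σ, P (Sum.inr σ))
    (nonterminal : ∀ s, (∀ a y, M.p s a y ≠ 0 → P y) → P (Sum.inl s)) (x : S ⊕ T) : P x := by
  have key : ∀ k : ℕ, ∀ x : S ⊕ T, M.horizon + 1 - M.level x = k → P x := by
    intro k
    induction k using Nat.strong_induction_on with
    | _ k ih =>
      intro x hk
      cases x with
      | inr σ => exact terminal σ
      | inl s =>
        refine nonterminal s fun a y hy => ih _ (hk ▸ ?_) y rfl
        exact M.sub_level_lt (M.parent_of_p_ne_zero s a y hy)
  exact key _ x rfl

/-- Play moves only from parent to child, so the path of a reached σ extends that of x by moves of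
π. The last clause says that a non-terminal x is itself left by one of these moves, which forces the
action taken there. -/
theorem exists_path_eq_append (M : TreeMDP S T A) (π : Policy S A) (σ : T) (x : S ⊕ T) :
    M.terminalLaw π x σ ≠ 0 →
      ∃ l, M.path (Sum.inr σ) = M.path x ++ l ∧ (∀ e ∈ l, π e.1 = e.2.1) ∧
        ∀ s, x = Sum.inl s → ∃ e ∈ l, e.1 = s := by
  induction x using M.policy_induction with
  | terminal σ' =>
    intro h
    have : σ = σ' := by
      by_contra hne
      simp [terminalLaw_terminal, PMF.pure_apply, hne] at h
    subst this
    exact ⟨[], by simp⟩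
  | nonterminal s ih =>
    intro h
    rw [terminalLaw_nonterminal, ← PMF.mem_support_iff, PMF.mem_support_bind_iff] at h
    obtain ⟨y, hy, hσ⟩ := h
    rw [PMF.mem_support_iff] at hy hσ
    obtain ⟨l, hl, hcons, -⟩ := ih _ y hy hσ
    rw [M.path_of_parent (M.parent_of_p_ne_zero _ _ _ hy), List.append_assoc] at hl
    refine ⟨_, hl, ?_, ?_⟩
    · intro e he
      rw [List.mem_append, List.mem_singleton] at he
      rcases he with rfl | he
      · rfl
      · exact hcons e he
    · rintro s' h'
      cases h'
      exact ⟨_, List.mem_append_left _ (List.mem_singleton_self _), rfl⟩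

theorem consistent_of_terminalLaw_ne_zero (M : TreeMDP S T A) {π : Policy S A} {σ : T}
    (h : M.terminalLaw π (Sum.inl M.root) σ ≠ 0) : M.Consistent π σ := by
  obtain ⟨l, hl, hcons, -⟩ := M.exists_path_eq_append π σ _ h
  rw [path_root, List.nil_append] at hl
  rw [Consistent, hl]
  exact hcons

theorem terminalLaw_eq_zero_of_ne (M : TreeMDP S T A) {π π' : Policy S A} {σ : T} {s : S}
    (h' : M.Consistent π' σ) (hs : π s ≠ π' s) : M.terminalLaw π (Sum.inl s) σ = 0 := by
  by_contra h
  obtain ⟨l, hl, hcons, hmem⟩ := M.exists_path_eq_append π σ _ h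
  obtain ⟨e, he, rfl⟩ := hmem s rfl
  refine hs ((hcons e he).trans (h' e ?_).symm)
  rw [hl]
  exact List.mem_append_right _ he

/-- Policies that are consistent with `σ` reach it with the same probability. -/
theorem terminalLaw_apply_congr (M : TreeMDP S T A) {π π' : Policy S A} {σ : T}
    (h : M.Consistent π σ) (h' : M.Consistent π' σ) (x : S ⊕ T) :
    M.terminalLaw π x σ = M.terminalLaw π' x σ := by
  induction x using M.policy_induction with
  | terminal σ' => simp only [terminalLaw_terminal]
  | nonterminal s ih =>
    by_cases hs : π s = π' s
    · rw [terminalLaw_nonterminal, terminalLaw_nonterminal, PMF.bind_apply, PMF.bind_apply, hs]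
      refine tsum_congr fun y => ?_
      by_cases hy : M.p s (π' s) y = 0
      · simp [hy]
      · rw [ih _ y hy]
    -- Where the policies disagree, σ is not reachable from s under either: its path would fix the
    -- action at s for both.
    · rw [M.terminalLaw_eq_zero_of_ne h' hs, M.terminalLaw_eq_zero_of_ne h (Ne.symm hs)]

/-! ### The value as expected return -/

theorem pathReturn_of_parent (M : TreeMDP S T A) {x : S ⊕ T} {s : S} {a : A}
    (h : M.parent x = some (s, a)) :
    M.pathReturn x = M.pathReturn (Sum.inl s) +
      M.γ ^ (M.path (Sum.inl s)).length * M.r s a x := by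
  simp [pathReturn, M.path_of_parent h, List.mapIdx_append]

theorem sum_terminalLaw_mul_nonterminal [Fintype S] [Fintype T] (M : TreeMDP S T A)
    (π : Policy S A) (s : S) (f : T → ℝ) :
    ∑ σ, (M.terminalLaw π (Sum.inl s) σ).toReal * f σ =
      ∑ y, (M.p s (π s) y).toReal * ∑ σ, (M.terminalLaw π y σ).toReal * f σ := by
  simp_rw [terminalLaw_nonterminal, PMF.bind_apply, tsum_fintype, Finset.mul_sum]
  rw [Finset.sum_comm]
  refine Finset.sum_congr rfl fun σ _ => ?_
  rw [ENNReal.toReal_sum fun y _ => ENNReal.mul_ne_top (PMF.apply_ne_top _ _)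
    (PMF.apply_ne_top _ _), Finset.sum_mul]
  simp_rw [ENNReal.toReal_mul, mul_assoc]

/-- Reward collected so far plus discounted reward to come is the expected total return. Including
the past keeps the same function of σ on the right throughout the induction, so no discount has to
be shifted. -/
theorem pathReturn_add_stateValue [Fintype S] [Fintype T] (M : TreeMDP S T A) (π : Policy S A)
    (x : S ⊕ T) :
    M.pathReturn x + M.γ ^ (M.path x).length * M.stateValue π x =
      ∑ σ, (M.terminalLaw π x σ).toReal * M.pathReturn (Sum.inr σ) := by
  classical
  induction x using M.policy_induction with
  | terminal σ =>
    rw [stateValue_terminal, terminalLaw_terminal, Finset.sum_eq_single σ]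
    · simp
    · intro b _ hb
      simp [PMF.pure_apply, hb]
    · simp
  | nonterminal s ih =>
    rw [sum_terminalLaw_mul_nonterminal, stateValue_bellman, Finset.mul_sum,
      ← one_mul (M.pathReturn _), ← (M.p s (π s)).sum_toReal, Finset.sum_mul,
      ← Finset.sum_add_distrib]
    refine Finset.sum_congr rfl fun y _ => ?_
    by_cases hy : M.p s (π s) y = 0
    · simp [hy]
    · have hpar := M.parent_of_p_ne_zero _ _ _ hy
      rw [← ih _ y hy, M.pathReturn_of_parent hpar, M.path_of_parent hpar, List.length_append,
        List.length_singleton]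
      ring

theorem value_eq_sum [Fintype S] [Fintype T] (M : TreeMDP S T A) (π : Policy S A) :
    M.value π = ∑ σ ∈ M.X π,
      (M.terminalLaw π (Sum.inl M.root) σ).toReal * M.pathReturn (Sum.inr σ) := by
  have h := M.pathReturn_add_stateValue π (Sum.inl M.root)
  simp only [pathReturn, M.path_root, List.mapIdx_nil, List.sum_nil, List.length_nil, pow_zero,
    one_mul, zero_add] at h
  rw [value, h]
  refine (Finset.sum_subset (Finset.subset_univ _) fun σ _ hσ => ?_).symm
  have h0 : M.terminalLaw π (Sum.inl M.root) σ = 0 := by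
    by_contra h0
    exact hσ (by simpa [X] using M.consistent_of_terminalLaw_ne_zero h0)
  simp [h0]

theorem value_nonneg [Fintype S] [Fintype T] (M : TreeMDP S T A)
    (hreturn : ∀ σ : T, M.pathReturn (Sum.inr σ) ∈ Set.Icc (0 : ℝ) 1) (π : Policy S A) :
    0 ≤ M.value π := by
  rw [value_eq_sum]
  exact Finset.sum_nonneg fun σ _ => mul_nonneg ENNReal.toReal_nonneg (hreturn σ).1

theorem sum_terminalLaw_le_one [Fintype T] (M : TreeMDP S T A) (π : Policy S A) (s : Finset T) :
    ∑ σ ∈ s, (M.terminalLaw π (Sum.inl M.root) σ).toReal ≤ 1 :=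
  (Finset.sum_le_univ_sum_of_nonneg fun _ => ENNReal.toReal_nonneg).trans_eq (PMF.sum_toReal _)

theorem value_le_one [Fintype S] [Fintype T] (M : TreeMDP S T A)
    (hreturn : ∀ σ : T, M.pathReturn (Sum.inr σ) ∈ Set.Icc (0 : ℝ) 1) (π : Policy S A) :
    M.value π ≤ 1 := by
  rw [value_eq_sum]
  exact (Finset.sum_le_sum fun σ _ =>
    mul_le_of_le_one_right ENNReal.toReal_nonneg (hreturn σ).2).trans
      (M.sum_terminalLaw_le_one π _)

/-! ### The exponential supermartingale -/

open Classical in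
/-- The log-weight of an episode, for coefficients `c` on the terminal states in `X(π)`. -/
noncomputable def logWeight [Fintype T] (M : TreeMDP S T A) (π : Policy S A) (c : T → ℝ)
    (e : Policy S A × Trajectory S T A) : ℝ :=
  ∑ σ ∈ M.X π, ((if e.2.2 = σ then c σ else 0) -
    if M.Consistent e.1 σ then
      (c σ + 2 / 3 * c σ ^ 2) * (M.terminalLaw π (Sum.inl M.root) σ).toReal
    else 0)

theorem sum_map_logWeight [Fintype T] (M : TreeMDP S T A) (π : Policy S A) (c : T → ℝ)
    (h : History S T A) :
    (h.map (M.logWeight π c)).sum = ∑ σ ∈ M.X π, (reachCount h σ * c σ -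
      M.playCount h σ *
        ((c σ + 2 / 3 * c σ ^ 2) * (M.terminalLaw π (Sum.inl M.root) σ).toReal)) := by
  classical
  induction h with
  | nil => simp [reachCount, playCount]
  | cons e h ih =>
    rw [List.map_cons, List.sum_cons, ih, logWeight, ← Finset.sum_add_distrib]
    refine Finset.sum_congr rfl fun σ _ => ?_
    simp only [reachCount, playCount, List.countP_cons, decide_eq_true_eq]
    push_cast
    split_ifs <;> ring

/-- Real form of the one-step supermartingale inequality. -/
theorem sum_terminalLaw_mul_exp_le [Fintype T] (M : TreeMDP S T A) (π π' : Policy S A)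
    (c : T → ℝ) (hc : ∀ σ ∈ M.X π, |c σ| ≤ 3 / 4) (l : List (S × A)) :
    ∑ σ, (M.terminalLaw π' (Sum.inl M.root) σ).toReal *
      Real.exp (M.logWeight π c (π', l, σ)) ≤ 1 := by
  classical
  set q := fun σ => (M.terminalLaw π (Sum.inl M.root) σ).toReal with hq
  set q' := fun σ => (M.terminalLaw π' (Sum.inl M.root) σ).toReal with hq'
  set d := ∑ σ ∈ M.X π, if M.Consistent π' σ then (c σ + 2 / 3 * c σ ^ 2) * q σ else 0 with hd
  have hlog : ∀ σ, M.logWeight π c (π', l, σ) = (if σ ∈ M.X π then c σ else 0) - d := by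
    intro σ
    rw [logWeight, Finset.sum_sub_distrib, Finset.sum_ite_eq]
  have hterm : ∀ σ, q' σ * Real.exp (if σ ∈ M.X π then c σ else 0) ≤
      q' σ + if σ ∈ M.X π then
        (if M.Consistent π' σ then (c σ + 2 / 3 * c σ ^ 2) * q σ else 0) else 0 := by
    intro σ
    by_cases hσ : σ ∈ M.X π
    · rw [if_pos hσ, if_pos hσ]
      by_cases h' : M.Consistent π' σ
      · have hqq : q' σ = q σ := by
          rw [hq, hq']
          simp only
          rw [M.terminalLaw_apply_congr h' (by simpa [X] using hσ)]
        rw [if_pos h', hqq]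
        have := mul_le_mul_of_nonneg_left (Real.exp_le_one_add_add_sq (hc σ hσ))
          (ENNReal.toReal_nonneg : 0 ≤ q σ)
        linarith
      · have h0 : q' σ = 0 := by
          by_contra h0
          exact h' (M.consistent_of_terminalLaw_ne_zero fun h1 => h0 (by simp [hq', h1]))
        simp [h0, h']
    · simp [hσ]
  have hsum : ∑ σ, q' σ * Real.exp (if σ ∈ M.X π then c σ else 0) ≤ 1 + d := by
    refine (Finset.sum_le_sum fun σ _ => hterm σ).trans_eq ?_
    rw [Finset.sum_add_distrib, PMF.sum_toReal, Finset.sum_ite_mem, Finset.univ_inter]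
  simp_rw [hlog, Real.exp_sub, ← mul_div_assoc, ← Finset.sum_div]
  rw [div_le_one (Real.exp_pos d)]
  -- The normalizer exp d absorbs the bound 1 + d.
  linarith [Real.add_one_le_exp d]

theorem tsum_rollout_mul_exp_le [Fintype T] (M : TreeMDP S T A) (π π' : Policy S A)
    (c : T → ℝ) (hc : ∀ σ ∈ M.X π, |c σ| ≤ 3 / 4) :
    ∑' τ, M.rollout π' (Sum.inl M.root) τ *
      ENNReal.ofReal (Real.exp (M.logWeight π c (π', τ))) ≤ 1 := by
  -- The log-weight sees only the terminal state of a trajectory, so the empty list can stand for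
  -- the moves.
  have h := PMF.tsum_map_mul (M.rollout π' (Sum.inl M.root)) Prod.snd
    fun σ => ENNReal.ofReal (Real.exp (M.logWeight π c (π', [], σ)))
  refine (h.symm.trans_le ?_ :)
  rw [tsum_fintype]
  calc _ = ENNReal.ofReal (∑ σ, (M.terminalLaw π' (Sum.inl M.root) σ).toReal *
        Real.exp (M.logWeight π c (π', [], σ))) := by
        rw [ENNReal.ofReal_sum_of_nonneg fun σ _ =>
          mul_nonneg ENNReal.toReal_nonneg (Real.exp_pos _).le]
        refine Finset.sum_congr rfl fun σ _ => ?_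
        rw [ENNReal.ofReal_mul ENNReal.toReal_nonneg,
          ENNReal.ofReal_toReal (PMF.apply_ne_top _ _), terminalLaw]
    _ ≤ 1 := by
        rw [ENNReal.ofReal_le_one]
        exact M.sum_terminalLaw_mul_exp_le π π' c hc []

/-- The weight of a history; zero once the algorithm has stopped. -/
noncomputable def runWeight [Fintype T] (M : TreeMDP S T A) (π : Policy S A) (c : T → ℝ) :
    Option (History S T A) → ℝ≥0∞
  | none => 0
  | some h => ENNReal.ofReal (Real.exp (h.map (M.logWeight π c)).sum)

/-- Each policy is chosen before its episode, so the one-step bound holds conditionally on the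
history and the choice; stopping sets the weight to 0 and only decreases the mean. -/
theorem tsum_run_mul_runWeight_le [Fintype T] (M : TreeMDP S T A) (alg : Algorithm S T A)
    (π : Policy S A) (c : T → ℝ) (hc : ∀ σ ∈ M.X π, |c σ| ≤ 3 / 4) (t : ℕ) :
    ∑' o, M.run alg t o * M.runWeight π c o ≤ 1 := by
  induction t with
  | zero =>
    rw [run, PMF.tsum_pure_mul]
    simp [runWeight]
  | succ t ih =>
    rw [run, PMF.tsum_bind_mul]
    refine (ENNReal.tsum_le_tsum fun o => mul_le_mul_right ?_ _).trans ih
    cases o with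
    | none => simp [runWeight]
    | some h =>
      simp only [PMF.tsum_bind_mul]
      calc _ ≤ ∑' a, alg h a * M.runWeight π c (some h) := by
            refine ENNReal.tsum_le_tsum fun a => mul_le_mul_right ?_ _
            cases a with
            | none => simp [runWeight]
            | some π' =>
              simp only [PMF.tsum_map_mul, runWeight, List.map_append, List.sum_append,
                List.map_singleton, List.sum_singleton, Real.exp_add,
                ENNReal.ofReal_mul (Real.exp_pos _).le, mul_left_comm _ (ENNReal.ofReal _),
                ENNReal.tsum_mul_left]
              exact mul_le_of_le_one_right' (M.tsum_rollout_mul_exp_le π π' c hc)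
        _ = _ := by rw [ENNReal.tsum_mul_right, PMF.tsum_coe, one_mul]

/-- Markov's inequality for the weight of the history. -/
theorem runProb_le_of_log_le [Fintype T] (M : TreeMDP S T A) (alg : Algorithm S T A)
    (π : Policy S A) (c : T → ℝ) (hc : ∀ σ ∈ M.X π, |c σ| ≤ 3 / 4) (t : ℕ)
    (E : History S T A → Prop) {δ : ℝ} (hδ : 0 < δ)
    (hE : ∀ h, E h → Real.log (1 / δ) ≤ (h.map (M.logWeight π c)).sum) :
    M.runProb alg t E ≤ ENNReal.ofReal δ := by
  rw [runProb, PMF.toOuterMeasure_apply]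
  calc _ ≤ ∑' o, M.run alg t o * M.runWeight π c o * ENNReal.ofReal δ := by
        refine ENNReal.tsum_le_tsum fun o => Set.indicator_apply_le' (fun ho => ?_) fun _ => zero_le
        obtain ⟨h, rfl, hh⟩ := ho
        rw [mul_assoc, runWeight, ← ENNReal.ofReal_mul (Real.exp_pos _).le]
        refine le_mul_of_one_le_right' (ENNReal.one_le_ofReal.2 ?_)
        have h1 := Real.exp_le_exp.2 (hE h hh)
        rw [Real.exp_log (one_div_pos.2 hδ)] at h1
        exact (div_le_iff₀ hδ).1 h1
    _ ≤ ENNReal.ofReal δ := by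
        rw [ENNReal.tsum_mul_right]
        exact mul_le_of_le_one_left' (M.tsum_run_mul_runWeight_le alg π c hc t)

/-! ### Deviation of the estimate -/

/-- With coefficients `k ρ(σ) / n(σ)`, the log-weight of a history with counts `n` dominates the
deviation of the estimate, up to a quadratic term. -/
theorem le_sum_map_logWeight [Fintype S] [Fintype T] (M : TreeMDP S T A)
    (hreturn : ∀ σ : T, M.pathReturn (Sum.inr σ) ∈ Set.Icc (0 : ℝ) 1) (π : Policy S A)
    (n : T → ℕ) {m : ℕ} (hm : 0 < m) (hmn : ∀ σ ∈ M.X π, m ≤ n σ) (k : ℝ) (h : History S T A)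
    (hcount : ∀ σ ∈ M.X π, M.playCount h σ = n σ) :
    k * (M.valueEstimate h π - M.value π) - 2 / 3 * (k ^ 2 / m) ≤
      (h.map (M.logWeight π fun σ => k * M.pathReturn (Sum.inr σ) / n σ)).sum := by
  have hm' : (0 : ℝ) < m := by exact_mod_cast hm
  -- The quadratic error is bounded state by state with weight q(σ); these weights sum to at most 1,
  -- so the bound does not grow with the number of terminal states.
  have hbound : 2 / 3 * (k ^ 2 / m) *
      ∑ σ ∈ M.X π, (M.terminalLaw π (Sum.inl M.root) σ).toReal ≤ 2 / 3 * (k ^ 2 / m) :=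
    mul_le_of_le_one_right (by positivity) (M.sum_terminalLaw_le_one π _)
  refine (sub_le_sub_left hbound _).trans ?_
  rw [sum_map_logWeight, valueEstimate, value_eq_sum, ← Finset.sum_sub_distrib, Finset.mul_sum,
    Finset.mul_sum, ← Finset.sum_sub_distrib]
  refine Finset.sum_le_sum fun σ hσ => ?_
  rw [hcount σ hσ]
  have hn : (m : ℝ) ≤ n σ := by exact_mod_cast hmn σ hσ
  have hn0 : (0 : ℝ) < n σ := hm'.trans_le hn
  have hρ : M.pathReturn (Sum.inr σ) ^ 2 ≤ 1 := pow_le_one₀ (hreturn σ).1 (hreturn σ).2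
  have hq : 0 ≤ (M.terminalLaw π (Sum.inl M.root) σ).toReal := ENNReal.toReal_nonneg
  generalize (M.terminalLaw π (Sum.inl M.root) σ).toReal = q at hq ⊢
  generalize M.pathReturn (Sum.inr σ) = ρ at hρ ⊢
  have hquad : k ^ 2 * ρ ^ 2 / n σ ≤ k ^ 2 / m :=
    div_le_div₀ (sq_nonneg k) (mul_le_of_le_one_right (sq_nonneg k) hρ) hm' hn
  have hexpand : (reachCount h σ : ℝ) * (k * ρ / n σ) -
      n σ * ((k * ρ / n σ + 2 / 3 * (k * ρ / n σ) ^ 2) * q) =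
      k * (reachCount h σ / n σ * ρ - q * ρ) - 2 / 3 * (k ^ 2 * ρ ^ 2 / n σ) * q := by
    field_simp
    ring
  rw [hexpand]
  have := mul_le_mul_of_nonneg_right hquad hq
  linarith

theorem sq_width {m : ℕ} {δ : ℝ} (hδ : δ ∈ Set.Ioo (0 : ℝ) 1) :
    width m δ ^ 2 = 8 / (3 * (m : ℝ)) * Real.log (1 / δ) := by
  refine Real.sq_sqrt (mul_nonneg (by positivity) (Real.log_nonneg ?_))
  exact (one_le_div hδ.1).2 hδ.2.le

/-- Both tails at once: `s = 1` for overestimation, `s = -1` for underestimation. -/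
theorem runProb_deviation_le [Fintype S] [Fintype T] (M : TreeMDP S T A)
    (hreturn : ∀ σ : T, M.pathReturn (Sum.inr σ) ∈ Set.Icc (0 : ℝ) 1)
    (alg : Algorithm S T A) (π : Policy S A) (t : ℕ) (n : T → ℕ) (hn : ∀ σ ∈ M.X π, 1 ≤ n σ)
    {δ : ℝ} (hδ : δ ∈ Set.Ioo (0 : ℝ) 1) {s : ℝ} (hs : s ^ 2 = 1) (E : History S T A → Prop)
    (hcount : ∀ h, E h → ∀ σ ∈ M.X π, M.playCount h σ = n σ)
    (hwidth : ∀ h, E h → width (M.policyCount h π) δ ≤ 1)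
    (hdev : ∀ h, E h →
      width (M.policyCount h π) δ ≤ s * (M.valueEstimate h π - M.value π)) :
    M.runProb alg t E ≤ ENNReal.ofReal δ := by
  set m := (M.X π).inf' (M.X_nonempty π) n with hm
  have hpc : ∀ h, E h → M.policyCount h π = m := fun h hE =>
    Finset.inf'_congr _ rfl fun σ hσ => hcount h hE σ hσ
  have hm0 : 0 < m := (Finset.lt_inf'_iff _).2 hn
  have hm0' : (0 : ℝ) < m := by exact_mod_cast hm0
  have hmn : ∀ σ ∈ M.X π, m ≤ n σ := fun σ hσ => Finset.inf'_le _ hσ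
  have hw0 : 0 ≤ width m δ := Real.sqrt_nonneg _
  -- A width above 1 would violate the smallness condition on the coefficients, but then `hwidth`
  -- makes the event empty.
  by_cases hw1 : width m δ ≤ 1
  · have hs1 : |s| = 1 := by
      rw [← Real.sqrt_sq_eq_abs, hs, Real.sqrt_one]
    -- With w the width, k = 3/4 m w maximizes k w - 2/3 k² / m; the maximum 3/8 m w² equals log (1
    -- / δ).
    refine M.runProb_le_of_log_le alg π
      (fun σ => s * (3 / 4 * m * width m δ) * M.pathReturn (Sum.inr σ) / n σ) ?_ t E hδ.1 ?_
    · intro σ hσ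
      have hnσ : (m : ℝ) ≤ n σ := by exact_mod_cast hmn σ hσ
      have hn0 : (0 : ℝ) < n σ := hm0'.trans_le hnσ
      rw [abs_div, abs_mul, abs_mul, hs1, one_mul, abs_of_nonneg (hreturn σ).1,
        abs_of_nonneg (by positivity : 0 ≤ 3 / 4 * m * width m δ), abs_of_pos hn0, div_le_iff₀ hn0]
      calc _ ≤ 3 / 4 * m * width m δ := mul_le_of_le_one_right (by positivity) (hreturn σ).2
        _ ≤ 3 / 4 * m := mul_le_of_le_one_right (by positivity) hw1
        _ ≤ _ := by linarith
    · intro h hE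
      refine le_trans ?_ (M.le_sum_map_logWeight hreturn π n hm0 hmn _ h (hcount h hE))
      have hd := hdev h hE
      rw [hpc h hE] at hd
      have hsq : m * width m δ ^ 2 = 8 / 3 * Real.log (1 / δ) := by
        rw [sq_width hδ]
        field_simp
      have hk : (s * (3 / 4 * m * width m δ)) ^ 2 / m = 9 / 16 * (m * width m δ ^ 2) := by
        rw [mul_pow, hs]
        field_simp
        ring
      have hlin := mul_le_mul_of_nonneg_left hd (by positivity : 0 ≤ 3 / 4 * m * width m δ)
      rw [hk]
      linarith
  · have hempty : ∀ h, ¬ E h := fun h hE => hw1 (hpc h hE ▸ hwidth h hE)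
    simp [runProb, hempty]

theorem valueEstimate_nonneg [Fintype T] (M : TreeMDP S T A)
    (hreturn : ∀ σ : T, M.pathReturn (Sum.inr σ) ∈ Set.Icc (0 : ℝ) 1) (h : History S T A)
    (π : Policy S A) : 0 ≤ M.valueEstimate h π :=
  Finset.sum_nonneg fun σ _ => mul_nonneg (by positivity) (hreturn σ).1

end TreeMDP

/-! ### The two confidence bounds -/

theorem theorem1 {S T A : Type*} [Fintype S] [Fintype T] (M : TreeMDP S T A)
    (hreturn : ∀ σ : T, M.pathReturn (Sum.inr σ) ∈ Set.Icc (0 : ℝ) 1)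
    (alg : TreeMDP.Algorithm S T A) (π : TreeMDP.Policy S A)
    (t : ℕ) (ht : 1 ≤ t) (n : T → ℕ) (hn : ∀ σ ∈ M.X π, 1 ≤ n σ ∧ n σ ≤ t)
    (δ : ℝ) (hδ : δ ∈ Set.Ioo (0 : ℝ) 1) :
    M.runProb alg t
        (fun h => (∀ σ ∈ M.X π, M.playCount h σ = n σ) ∧ M.value π ≥ M.ucb h π δ)
      ≤ ENNReal.ofReal δ ∧
    M.runProb alg t
        (fun h => (∀ σ ∈ M.X π, M.playCount h σ = n σ) ∧ M.value π ≤ M.lcb h π δ)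
      ≤ ENNReal.ofReal δ := by
  have h0 := M.value_nonneg hreturn π
  have h1 := M.value_le_one hreturn π
  constructor
  · refine M.runProb_deviation_le hreturn alg π t n (fun σ hσ => (hn σ hσ).1) hδ
      (s := -1) (by norm_num) _ (fun h hE => hE.1) ?_ ?_
    -- The width is at most 1 because the value is at most 1 and the estimate nonnegative.
    · rintro h ⟨-, hE⟩
      have := M.valueEstimate_nonneg hreturn h π
      rw [TreeMDP.ucb] at hE
      linarith
    · rintro h ⟨-, hE⟩
      rw [TreeMDP.ucb] at hE
      linarith
  · refine M.runProb_deviation_le hreturn alg π t n (fun σ hσ => (hn σ hσ).1) hδ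
      (s := 1) (by norm_num) _ (fun h hE => hE.1) ?_ ?_
    -- Here the truncation at 1 matters: the estimate may exceed 1, since its terms have different
    -- denominators.
    · rintro h ⟨-, hE⟩
      rw [TreeMDP.lcb] at hE
      linarith [min_le_right (M.valueEstimate h π) 1]
    · rintro h ⟨-, hE⟩
      rw [TreeMDP.lcb] at hE
      linarith [min_le_left (M.valueEstimate h π) 1]
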